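/- Let $X$ be a complex Hilbert space and $Y$ a complex Banach space, let $E\in L(X;Y)$ and let $A:\operatorname{dom}(A)\subseteq X\to Y$ be a densely defined closed linear operator. Define the Wong sequence of $(E,A)$ by $\operatorname{IV}_0=\operatorname{dom}(A)$ and $\operatorname{IV}_{k+1}=A^{-1}[E[\operatorname{IV}_k]]$ for $k\in\mathbb{N}=\{0,1,2,\dots\}$. For $u_0\in X$, a mild solution with initial value $u_0$ is a continuous function $u:[0,\infty)\to X$ such that $u(0)=u_0$ and, for all $t>0$, $\int_0^t u(s)\,ds\in\operatorname{dom}(A)$ and $$Eu(t)+A\int_0^t u(s)\,ds=Eu_0 .$$ Let $U$ be the set of all $u_0\in X$ for which a mild solution exists. Let $\rho_0\in\mathbb{R}$ be such that for every $z\in\mathbb{C}$ with $\operatorname{Re}z\ge\rho_0$ the operator $zE+A:\operatorname{dom}(A)\to Y$ has an inverse $(zE+A)^{-1}\in L(Y;X)$, and such that there are $C\ge0$ and $k\in\mathbb{N}$ with $$\|(zE+A)^{-1}\|\le C|z|^k\qquad(\operatorname{Re}z\ge\rho_0).$$ Let $\operatorname{ind}(E,A)$ be the least $k\in\mathbb{N}$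 for which such a $C\ge 0$ exists (for this $\rho_0$). Assume moreover that $U$ is closed and that for each $u_0\in U$ the mild solution with initial value $u_0$ is unique. Then $$U=\overline{\operatorname{IV}_{\operatorname{ind}(E,A)+1}} .$$ -/

import Mathlib

namespace DAE

section
variable {X Y : Type*} [NormedAddCommGroup X] [NormedSpace ℂ X]
  [NormedAddCommGroup Y] [NormedSpace ℂ Y]

/-- The Wong sequence of `(E, A)`: `IV 0 = dom A` and `IV (k + 1) = A⁻¹[E[IV k]]`. -/
def IV (E : X →L[ℂ] Y) (A : X →ₗ.[ℂ] Y) : ℕ → Submodule ℂ X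
  | 0 => A.domain
  | k + 1 => (((IV E A k).map E.toLinearMap).comap A.toFun).map A.domain.subtype

theorem mem_IV_zero (E : X →L[ℂ] Y) (A : X →ₗ.[ℂ] Y) (x : X) :
    x ∈ IV E A 0 ↔ x ∈ A.domain := Iff.rfl

theorem mem_IV_succ (E : X →L[ℂ] Y) (A : X →ₗ.[ℂ] Y) (k : ℕ) (x : X) :
    x ∈ IV E A (k + 1) ↔ ∃ hx : x ∈ A.domain, ∃ y ∈ IV E A k, E y = A ⟨x, hx⟩ := by
  constructor
  · rintro ⟨⟨x, hx⟩, ⟨y, hy, hxy⟩, rfl⟩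
    exact ⟨hx, y, hy, hxy⟩
  · rintro ⟨hx, y, hy, hxy⟩
    exact ⟨⟨x, hx⟩, ⟨y, hy, hxy⟩, rfl⟩

/-- The operator pencil `z E + A`, with domain `dom A`. -/
def pencil (E : X →L[ℂ] Y) (A : X →ₗ.[ℂ] Y) (z : ℂ) : X →ₗ.[ℂ] Y :=
  (z • E.toLinearMap) +ᵥ A

theorem pencil_domain (E : X →L[ℂ] Y) (A : X →ₗ.[ℂ] Y) (z : ℂ) :
    (pencil E A z).domain = A.domain := rfl

theorem pencil_apply (E : X →L[ℂ] Y) (A : X →ₗ.[ℂ] Y) (z : ℂ) (x : A.domain) :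
    (pencil E A z) x = z • E x + A x := rfl

/-- `R` is a two-sided bounded inverse of the (possibly unbounded) operator `T`. -/
def IsBoundedInverse (T : X →ₗ.[ℂ] Y) (R : Y →L[ℂ] X) : Prop :=
  (∀ x : T.domain, R (T x) = x) ∧ ∀ y : Y, ∃ h : R y ∈ T.domain, T ⟨R y, h⟩ = y

/-- The resolvent set `ρ(E, A)` of all `z` with `(z E + A)⁻¹ ∈ L(Y; X)`. -/
def resolventSet (E : X →L[ℂ] Y) (A : X →ₗ.[ℂ] Y) : Set ℂ :=
  {z | ∃ R : Y →L[ℂ] X, IsBoundedInverse (pencil E A z) R}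

open Classical in
/-- The operator `(z E + A)⁻¹` for `z` in the resolvent set (and `0` otherwise). -/
noncomputable def resolvent (E : X →L[ℂ] Y) (A : X →ₗ.[ℂ] Y) (z : ℂ) : Y →L[ℂ] X :=
  if h : ∃ R : Y →L[ℂ] X, IsBoundedInverse (pencil E A z) R then h.choose else 0

theorem resolvent_spec (E : X →L[ℂ] Y) (A : X →ₗ.[ℂ] Y) {z : ℂ}
    (hz : z ∈ resolventSet E A) : IsBoundedInverse (pencil E A z) (resolvent E A z) := by
  have h : ∃ R : Y →L[ℂ] X, IsBoundedInverse (pencil E A z) R := hz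
  rw [resolvent, dif_pos h]
  exact h.choose_spec

theorem IsBoundedInverse.unique {T : X →ₗ.[ℂ] Y} {R S : Y →L[ℂ] X}
    (hR : IsBoundedInverse T R) (hS : IsBoundedInverse T S) : R = S := by
  ext y
  obtain ⟨h, hy⟩ := hR.2 y
  have := hS.1 ⟨R y, h⟩
  rw [hy] at this
  exact this.symm

/-- `‖(z E + A)⁻¹‖ ≤ C |z| ^ k` on the closed half plane `Re z ≥ ρ₀`, for some `C ≥ 0`. -/
def ResolventBound (E : X →L[ℂ] Y) (A : X →ₗ.[ℂ] Y) (ρ₀ : ℝ) (k : ℕ) : Prop :=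
  ∃ C : ℝ, 0 ≤ C ∧ ∀ z : ℂ, ρ₀ ≤ z.re → ‖resolvent E A z‖ ≤ C * ‖z‖ ^ k

/-- The closed half plane `Re z ≥ ρ₀` lies in the resolvent set and the resolvent is
polynomially bounded there. -/
def PolynomiallyBounded (E : X →L[ℂ] Y) (A : X →ₗ.[ℂ] Y) (ρ₀ : ℝ) : Prop :=
  {z : ℂ | ρ₀ ≤ z.re} ⊆ resolventSet E A ∧ ∃ k : ℕ, ResolventBound E A ρ₀ k

/-- The index of `(E, A)` (on `Re z ≥ ρ₀`): the least exponent in the resolvent bound. -/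
noncomputable def ind (E : X →L[ℂ] Y) (A : X →ₗ.[ℂ] Y) (ρ₀ : ℝ) : ℕ :=
  sInf {k : ℕ | ResolventBound E A ρ₀ k}

/-- `u` (considered on `[0, ∞)` only) is a mild solution of `E u' + A u = 0`, `u 0 = u₀`. -/
def IsMildSolution (E : X →L[ℂ] Y) (A : X →ₗ.[ℂ] Y) (u₀ : X) (u : ℝ → X) : Prop :=
  ContinuousOn u (Set.Ici 0) ∧ u 0 = u₀ ∧
    ∀ t : ℝ, 0 < t → ∃ h : (∫ s in (0 : ℝ)..t, u s) ∈ A.domain,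
      E (u t) + A ⟨∫ s in (0 : ℝ)..t, u s, h⟩ = E u₀

/-- The space `U` of consistent initial values. -/
def consistentInitialValues (E : X →L[ℂ] Y) (A : X →ₗ.[ℂ] Y) : Set X :=
  {u₀ | ∃ u : ℝ → X, IsMildSolution E A u₀ u}

end

end DAE

/-!
The set `U` of consistent initial values and the Wong space `IV (k + 1)`, with `k` the index, are
compared in both directions by elementary means. In both, a vector is shown to lie in `dom A` by
writing it as a value of a resolvent `(zE + A)⁻¹` (`exists_mem_domain_of_resolvent`), so that
integrals only have to be commuted with bounded operators.

Every mild solution starts in the closure of *every* `IV n`. For a smooth weight `φ` supported in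
`(0, b)` put `x_φ = ∫ φ u`. Integration by parts against `∫₀ᵗ u` turns the mild equation into
`x_φ ∈ dom A` and `A x_φ = E x_φ'` (`IsMildSolution.apply_average`), and since `φ'` is again such a
weight, induction on `n` gives `x_φ ∈ IV n`. Letting `φ` concentrate at `0` from the right,
`x_φ` tends to `u 0`.

Conversely, `IV (k + 1) ⊆ U`, and `U` is closed by assumption. For `y ∈ Y` the function
`z ^ (-(k + 2)) (zE + A)⁻¹ y` is of order `|z|⁻²`, so its inverse Laplace transform `w` converges
absolutely. It is continuous, satisfies `w 0 = 0` by Cauchy's theorem, and solves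
`E w(t) + A ∫₀ᵗ w = t ^ (k + 2) / (k + 2)! • y` (`exists_isPowerResponse`). For `x ∈ dom A`, if `w`
solves this equation with right-hand side `t ^ (m + 1) / (m + 1)! • A x`, then
`t ^ m / m! • x - w` solves it with right-hand side `t ^ m / m! • E x` (`IsPowerResponse.sub`).
Descending the chain `A x₀ = E x₁, …, A x_k = E x_(k+1)` given by `x₀ ∈ IV (k + 1)` lowers the
power of `t` to zero, where the equation is that of a mild solution with initial value `x₀`.
-/

open MeasureTheory Set Filter Topology

namespace DAE

section
variable {X Y : Type*} [NormedAddCommGroup X] [NormedSpace ℂ X]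
  [NormedAddCommGroup Y] [NormedSpace ℂ Y]

/-! ### Elementary facts on the resolvent -/

/-- The criterion by which integrals are shown to lie in `dom A`: an identity
`x = (zE + A)⁻¹ (z E x + y)` gives `x ∈ dom A` and `A x = y`. -/
theorem exists_mem_domain_of_resolvent {E : X →L[ℂ] Y} {A : X →ₗ.[ℂ] Y} {z : ℂ}
    (hz : z ∈ resolventSet E A) {x : X} {y : Y} (hx : x = resolvent E A z (z • E x + y)) :
    ∃ h : x ∈ A.domain, A ⟨x, h⟩ = y := by
  obtain ⟨h, hy⟩ := (resolvent_spec E A hz).2 (z • E x + y)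
  have h' : resolvent E A z (z • E x + y) ∈ A.domain := h
  have hy' : z • E (resolvent E A z (z • E x + y)) + A ⟨resolvent E A z (z • E x + y), h'⟩
    = z • E x + y := hy
  have hmem : x ∈ A.domain := by rw [hx]; exact h'
  have he : A ⟨resolvent E A z (z • E x + y), h'⟩ = A ⟨x, hmem⟩ := by
    congr 1; exact Subtype.ext hx.symm
  rw [he, ← hx] at hy'
  exact ⟨hmem, add_left_cancel hy'⟩

theorem resolvent_apply_of_mem {E : X →L[ℂ] Y} {A : X →ₗ.[ℂ] Y} {z : ℂ}
    (hz : z ∈ resolventSet E A) (x : A.domain) :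
    resolvent E A z (z • E x + A x) = x :=
  (resolvent_spec E A hz).1 x

/-! ### Mild solutions start in the closure of every Wong space -/

/-- Only the restriction of a mild solution to `[0, ∞)` matters, so it can be extended to the
negative half line by its initial value. -/
theorem IsMildSolution.exists_continuous {E : X →L[ℂ] Y} {A : X →ₗ.[ℂ] Y} {u₀ : X} {u : ℝ → X}
    (hu : IsMildSolution E A u₀ u) : ∃ v : ℝ → X, Continuous v ∧ IsMildSolution E A u₀ v := by
  obtain ⟨hc, h0, hs⟩ := hu
  have hcont : Continuous fun t : ℝ => u (max t 0) :=
    hc.comp_continuous (by fun_prop) fun t => le_max_right t 0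
  refine ⟨fun t => u (max t 0), hcont, hcont.continuousOn, by simpa using h0, fun t ht => ?_⟩
  have hint : ∫ s in (0 : ℝ)..t, u (max s 0) = ∫ s in (0 : ℝ)..t, u s := by
    refine intervalIntegral.integral_congr fun s hs => ?_
    rw [uIcc_of_le ht.le] at hs
    simp [max_eq_left hs.1]
  simpa only [hint, max_eq_left ht.le] using hs t ht

/-- The mild equation solved for `∫₀ᵗ u` by means of the resolvent. -/
theorem IsMildSolution.integral_eq {E : X →L[ℂ] Y} {A : X →ₗ.[ℂ] Y} {u₀ : X} {u : ℝ → X}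
    (hu : IsMildSolution E A u₀ u) {z : ℂ} (hz : z ∈ resolventSet E A) {t : ℝ} (ht : 0 ≤ t) :
    ∫ s in (0 : ℝ)..t, u s =
      resolvent E A z (E (z • (∫ s in (0 : ℝ)..t, u s) + u₀ - u t)) := by
  rcases ht.eq_or_lt with rfl | ht
  · simp [hu.2.1]
  · obtain ⟨h, he⟩ := hu.2.2 t ht
    have := resolvent_apply_of_mem hz ⟨_, h⟩
    rw [eq_sub_of_add_eq' he] at this
    rw [map_sub, map_add, map_smul, add_sub_assoc]
    exact this.symm

section Average
variable [CompleteSpace X] {E : X →L[ℂ] Y} {A : X →ₗ.[ℂ] Y} {u₀ : X} {u : ℝ → X}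

/-- Averages of a mild solution against smooth weights supported in `(0, b)` satisfy the
differential-algebraic equation, with the derivative moved to the weight. -/
theorem IsMildSolution.apply_average (hu : IsMildSolution E A u₀ u) (hc : Continuous u)
    {z : ℂ} (hz : z ∈ resolventSet E A) {φ : ℝ → ℝ} (hφ : ContDiff ℝ 1 φ) {b : ℝ} (hb : 0 ≤ b)
    (hφ0 : φ 0 = 0) (hφb : φ b = 0) :
    ∃ h : (∫ s in (0 : ℝ)..b, φ s • u s) ∈ A.domain,
      A ⟨∫ s in (0 : ℝ)..b, φ s • u s, h⟩ = E (∫ s in (0 : ℝ)..b, deriv φ s • u s) := by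
  apply exists_mem_domain_of_resolvent hz
  set v : ℝ → X := fun t => ∫ s in (0 : ℝ)..t, u s with hv
  have hvd : ∀ t, HasDerivAt v (u t) t := fun t =>
    intervalIntegral.integral_hasDerivAt_right (hc.intervalIntegrable _ _)
      (hc.stronglyMeasurableAtFilter _ _) hc.continuousAt
  have hvc : Continuous v := continuous_iff_continuousAt.2 fun t => (hvd t).continuousAt
  have hφd : ∀ t, HasDerivAt φ (deriv φ t) t := fun t =>
    (hφ.differentiable one_ne_zero t).hasDerivAt
  have hφc : Continuous (deriv φ) := hφ.continuous_deriv le_rfl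
  have hparts : ∫ s in (0 : ℝ)..b, φ s • u s = - ∫ s in (0 : ℝ)..b, deriv φ s • v s := by
    rw [intervalIntegral.integral_smul_deriv_eq_deriv_smul (fun t _ => hφd t) (fun t _ => hvd t)
      (hφc.intervalIntegrable _ _) (hc.intervalIntegrable _ _), hφ0, hφb]
    simp
  have hzero : ∫ s in (0 : ℝ)..b, deriv φ s = 0 := by
    rw [intervalIntegral.integral_eq_sub_of_hasDerivAt (fun t _ => hφd t)
      (hφc.intervalIntegrable _ _), hφ0, hφb, sub_zero]
  set K : X →L[ℂ] X := (resolvent E A z).comp E with hK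
  have hvK : ∀ t ∈ uIcc 0 b, deriv φ t • v t =
      K (z • (deriv φ t • v t) + deriv φ t • u₀ - deriv φ t • u t) := by
    intro t ht
    rw [uIcc_of_le hb] at ht
    have hvt : v t = K (z • v t + u₀ - u t) := hu.integral_eq hz ht.1
    conv_lhs => rw [hvt]
    rw [smul_comm z (deriv φ t), ← smul_add, ← smul_sub]
    exact ((K.restrictScalars ℝ).map_smul _ _).symm
  have hi1 : IntervalIntegrable (fun t => deriv φ t • v t) volume 0 b :=
    (hφc.smul hvc).intervalIntegrable _ _
  have hi2 : IntervalIntegrable (fun t => deriv φ t • u t) volume 0 b :=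
    (hφc.smul hc).intervalIntegrable _ _
  have hi3 : IntervalIntegrable (fun t => deriv φ t • u₀) volume 0 b :=
    (hφc.smul continuous_const).intervalIntegrable _ _
  -- integrate `hvK`; the term with the constant `u₀` drops out because `∫ φ' = 0`
  have key : ∫ s in (0 : ℝ)..b, deriv φ s • v s =
      K (z • (∫ s in (0 : ℝ)..b, deriv φ s • v s) - ∫ s in (0 : ℝ)..b, deriv φ s • u s) := by
    conv_lhs => rw [intervalIntegral.integral_congr hvK]
    have hi1z : IntervalIntegrable (fun t => z • (deriv φ t • v t)) volume 0 b := hi1.smul z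
    rw [K.intervalIntegral_comp_comm ((hi1z.add hi3).sub hi2),
      intervalIntegral.integral_sub (hi1z.add hi3) hi2,
      intervalIntegral.integral_add hi1z hi3, intervalIntegral.integral_smul,
      intervalIntegral.integral_smul_const, hzero, zero_smul, add_zero]
  have hfin : ∫ s in (0 : ℝ)..b, φ s • u s = K (z • (∫ s in (0 : ℝ)..b, φ s • u s)
      + ∫ s in (0 : ℝ)..b, deriv φ s • u s) := by
    rw [hparts]
    conv_lhs => rw [key]
    rw [← map_neg]
    congr 1
    rw [smul_neg]
    abel
  rw [hK, ContinuousLinearMap.comp_apply, map_add, map_smul] at hfin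
  exact hfin

theorem IsMildSolution.average_mem_IV (hu : IsMildSolution E A u₀ u) (hc : Continuous u)
    {z : ℂ} (hz : z ∈ resolventSet E A) {b : ℝ} (hb : 0 ≤ b) (n : ℕ) {φ : ℝ → ℝ}
    (hφ : ContDiff ℝ (⊤ : ℕ∞) φ) (hsupp : tsupport φ ⊆ Ioo 0 b) :
    ∫ s in (0 : ℝ)..b, φ s • u s ∈ IV E A n := by
  have hav : ∀ {φ : ℝ → ℝ}, ContDiff ℝ (⊤ : ℕ∞) φ → tsupport φ ⊆ Ioo 0 b →
      ∃ h : (∫ s in (0 : ℝ)..b, φ s • u s) ∈ A.domain,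
      A ⟨∫ s in (0 : ℝ)..b, φ s • u s, h⟩ = E (∫ s in (0 : ℝ)..b, deriv φ s • u s) := by
    intro φ hφ hsupp
    exact hu.apply_average hc hz (hφ.of_le (by exact_mod_cast le_top)) hb
      (image_eq_zero_of_notMem_tsupport fun h => (hsupp h).1.ne rfl)
      (image_eq_zero_of_notMem_tsupport fun h => (hsupp h).2.ne rfl)
  induction n generalizing φ with
  | zero => exact (hav hφ hsupp).1
  | succ n ih =>
    obtain ⟨h, he⟩ := hav hφ hsupp
    exact (mem_IV_succ E A n _).2 ⟨h, _, ih (contDiff_infty_iff_deriv.1 hφ).2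
      (tsupport_deriv_subset.trans hsupp), he.symm⟩

theorem IsMildSolution.initial_mem_closure_IV (hu : IsMildSolution E A u₀ u)
    {z : ℂ} (hz : z ∈ resolventSet E A) (n : ℕ) : u₀ ∈ closure (IV E A n : Set X) := by
  obtain ⟨u, hc, hu⟩ := hu.exists_continuous
  refine Metric.mem_closure_iff.2 fun ε hε => ?_
  obtain ⟨δ, hδ, hδε⟩ := Metric.continuous_iff.1 hc 0 (ε / 2) (by positivity)
  -- a bump supported strictly inside `(0, δ)`, where `u` is `ε / 2`-close to `u 0`
  let f : ContDiffBump (δ / 2) := ⟨δ / 8, δ / 4, by positivity, by linarith⟩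
  have hsuppt : tsupport (f.normed volume) ⊆ Ioo 0 δ := by
    rw [f.tsupport_normed_eq, Real.closedBall_eq_Icc]
    intro s hs
    have h1 : δ / 2 - δ / 4 ≤ s := hs.1
    have h2 : s ≤ δ / 2 + δ / 4 := hs.2
    exact ⟨by linarith, by linarith⟩
  have hmem := hu.average_mem_IV hc hz hδ.le n f.contDiff_normed hsuppt
  refine ⟨_, hmem, ?_⟩
  have hone : ∫ s in (0 : ℝ)..δ, f.normed volume s = 1 := by
    rw [intervalIntegral.integral_eq_integral_of_support_subset, f.integral_normed]
    exact (subset_tsupport _).trans (hsuppt.trans Ioo_subset_Ioc_self)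
  have hfc : Continuous (f.normed volume) := f.continuous_normed
  have hdiff : ∫ s in (0 : ℝ)..δ, f.normed volume s • (u s - u₀) =
      (∫ s in (0 : ℝ)..δ, f.normed volume s • u s) - u₀ := by
    simp_rw [smul_sub]
    have h1 : IntervalIntegrable (fun s => f.normed volume s • u s) volume 0 δ :=
      (hfc.smul hc).intervalIntegrable _ _
    have h2 : IntervalIntegrable (fun s => f.normed volume s • u₀) volume 0 δ :=
      (hfc.smul continuous_const).intervalIntegrable _ _
    rw [intervalIntegral.integral_sub h1 h2,
      intervalIntegral.integral_smul_const, hone, one_smul]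
  rw [dist_comm, dist_eq_norm, ← hdiff]
  calc ‖∫ s in (0 : ℝ)..δ, f.normed volume s • (u s - u₀)‖
      ≤ ∫ s in (0 : ℝ)..δ, f.normed volume s * (ε / 2) := by
        refine intervalIntegral.norm_integral_le_of_norm_le hδ.le (ae_of_all _ fun s hs => ?_)
          ((hfc.mul continuous_const).intervalIntegrable _ _)
        rw [norm_smul, Real.norm_of_nonneg (f.nonneg_normed s)]
        rcases hs.2.eq_or_lt with rfl | hsδ
        · have : f.normed volume s = 0 :=
            image_eq_zero_of_notMem_tsupport fun h => (hsuppt h).2.ne rfl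
          simp [this]
        · refine mul_le_mul_of_nonneg_left ?_ (f.nonneg_normed s)
          have := hδε s (by rw [Real.dist_0_eq_abs, abs_of_pos hs.1]; exact hsδ)
          rw [dist_eq_norm, hu.2.1] at this
          exact this.le
    _ = ε / 2 := by rw [intervalIntegral.integral_mul_const, hone, one_mul]
    _ < ε := by linarith

end Average

end

open scoped FourierTransform

section
variable {V : Type*} [NormedAddCommGroup V] [NormedSpace ℂ V]

/-! ### Integrals along vertical lines -/

/-- The parametrization `ξ ↦ c + 2πiξ` of the line `Re z = c`. The factor `2π` turns integrals
over `ξ` of `exp (z t) • g z` into inverse Laplace transforms without a normalizing factor. -/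
noncomputable def vline (c ξ : ℝ) : ℂ := c + (2 * Real.pi * ξ : ℝ) * Complex.I

@[simp]
theorem vline_re (c ξ : ℝ) : (vline c ξ).re = c := by simp [vline]

theorem continuous_vline (c : ℝ) : Continuous (vline c) := by unfold vline; fun_prop

theorem vline_ne_zero {c : ℝ} (hc : 0 < c) (ξ : ℝ) : vline c ξ ≠ 0 := by
  intro h
  have := congrArg Complex.re h
  rw [vline_re] at this
  exact hc.ne' this

theorem norm_vline_sq (c ξ : ℝ) : ‖vline c ξ‖ ^ 2 = c ^ 2 + (2 * Real.pi * ξ) ^ 2 := by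
  rw [vline, Complex.sq_norm, Complex.normSq_add_mul_I]

theorem norm_exp_vline_mul (c ξ t : ℝ) : ‖Complex.exp (vline c ξ * t)‖ = Real.exp (c * t) := by
  rw [Complex.norm_exp]
  simp

theorem integrable_inv_norm_vline_sq {c : ℝ} (hc : 0 < c) (M : ℝ) :
    Integrable fun ξ => M / ‖vline c ξ‖ ^ 2 := by
  have h := (integrable_inv_one_add_sq.comp_mul_left'
    (show 2 * Real.pi / c ≠ 0 by positivity)).const_mul (M * (c ^ 2)⁻¹)
  refine h.congr (ae_of_all _ fun ξ => ?_)
  have h1 : c ^ 2 + (2 * Real.pi * ξ) ^ 2 ≠ 0 := by positivity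
  have h2 : 1 + (2 * Real.pi / c * ξ) ^ 2 ≠ 0 := by positivity
  simp only [norm_vline_sq]
  field_simp

theorem integrable_comp_vline {W : Type*} [NormedAddCommGroup W] {c : ℝ} (hc : 0 < c)
    {g : ℂ → W} {M : ℝ}
    (hg : ContinuousOn g {z | c ≤ z.re}) (hM : ∀ z : ℂ, c ≤ z.re → ‖g z‖ ≤ M / ‖z‖ ^ 2) :
    Integrable fun ξ => g (vline c ξ) := by
  refine (integrable_inv_norm_vline_sq hc M).mono' ?_ (ae_of_all _ fun ξ => hM _ (vline_re c ξ).ge)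
  exact (hg.comp_continuous (continuous_vline c) fun ξ => (vline_re c ξ).ge).aestronglyMeasurable

theorem integrable_exp_vline_smul {c : ℝ} (t : ℝ) {g : ℝ → V} (hg : Integrable g) :
    Integrable fun ξ => Complex.exp (vline c ξ * t) • g ξ := by
  have hcont : Continuous fun ξ => Complex.exp (vline c ξ * t) := by
    have := continuous_vline c
    fun_prop
  exact hg.bdd_smul (Real.exp (c * t)) hcont.aestronglyMeasurable
    (ae_of_all _ fun ξ => (norm_exp_vline_mul c ξ t).le)

/-- The inverse Laplace transform `t ↦ ∫ exp (z t) • g dξ` along the line `z = c + 2πiξ` is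
continuous. -/
theorem continuous_integral_exp_vline_smul {c : ℝ} {g : ℝ → V} (hg : Integrable g) :
    Continuous fun t : ℝ => ∫ ξ, Complex.exp (vline c ξ * t) • g ξ := by
  refine continuous_iff_continuousAt.2 fun t₀ => ?_
  refine continuousAt_of_dominated (bound := fun ξ => Real.exp (|c| * (|t₀| + 1)) * ‖g ξ‖)
    (Eventually.of_forall fun t => (integrable_exp_vline_smul t hg).aestronglyMeasurable) ?_
    (hg.norm.const_mul _) (ae_of_all _ fun ξ => by fun_prop)
  filter_upwards [Metric.ball_mem_nhds t₀ one_pos] with t ht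
  refine ae_of_all _ fun ξ => ?_
  rw [norm_smul, norm_exp_vline_mul]
  have h1 : |t| ≤ |t₀| + 1 := by
    have h2 : |t - t₀| < 1 := ht
    have := abs_sub_abs_le_abs_sub t t₀
    linarith
  refine mul_le_mul_of_nonneg_right (Real.exp_le_exp.2 ?_) (norm_nonneg _)
  calc c * t ≤ |c * t| := le_abs_self _
    _ = |c| * |t| := abs_mul _ _
    _ ≤ _ := by gcongr

/-- Fubini's theorem for the time integral of an inverse Laplace transform. -/
theorem integral_integral_exp_vline_smul [CompleteSpace V] {c : ℝ} (hc : 0 < c) {g : ℝ → V}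
    (hg : Integrable g) (t : ℝ) :
    ∫ s in (0 : ℝ)..t, ∫ ξ, Complex.exp (vline c ξ * s) • g ξ =
      ∫ ξ, ((Complex.exp (vline c ξ * t) - 1) / vline c ξ) • g ξ := by
  rw [intervalIntegral_integral_swap]
  · congr 1 with ξ
    rw [intervalIntegral.integral_smul_const, integral_exp_mul_complex (vline_ne_zero hc ξ)]
    simp
  · have : IsFiniteMeasure (volume.restrict (uIoc 0 t)) :=
      inferInstanceAs (IsFiniteMeasure (volume.restrict (Ioc _ _)))
    have h1 : Integrable (fun p : ℝ × ℝ => g p.2)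
        ((volume.restrict (uIoc 0 t)).prod volume) :=
      hg.comp_snd _
    have hcont : Continuous fun p : ℝ × ℝ => Complex.exp (vline c p.2 * p.1) := by
      have := continuous_vline c
      fun_prop
    refine h1.bdd_smul (Real.exp (c * |t|)) hcont.aestronglyMeasurable ?_
    have h2 : ∀ᵐ s ∂(volume.restrict (uIoc 0 t)), Real.exp (c * s) ≤ Real.exp (c * |t|) := by
      refine (ae_restrict_iff' measurableSet_uIoc).2 (ae_of_all _ fun s hs => ?_)
      gcongr
      have := hs.2
      rcases le_total 0 t with h | h
      · rw [max_eq_right h] at this; exact this.trans (le_abs_self t)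
      · rw [max_eq_left h] at this; exact this.trans (abs_nonneg t)
    have h3 := Measure.ae_prod_mem_iff_ae_ae_mem (μ := volume.restrict (uIoc 0 t))
      (ν := (volume : Measure ℝ)) (s := {p : ℝ × ℝ | ‖Complex.exp (vline c p.2 * p.1)‖ ≤
        Real.exp (c * |t|)}) (measurableSet_le hcont.norm.measurable measurable_const)
    refine h3.2 ?_
    filter_upwards [h2] with s hs
    exact ae_of_all _ fun ξ => (norm_exp_vline_mul c ξ s).trans_le hs

/-- Contour shift: a function that is holomorphic on a closed right half plane and of order
`|z|⁻²` there has vanishing integral over the bounding line. -/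
theorem integral_comp_vline_eq_zero [CompleteSpace V] {c : ℝ} (hc : 0 < c) {g : ℂ → V} {M : ℝ}
    (hg : DifferentiableOn ℂ g {z | c ≤ z.re})
    (hM : ∀ z : ℂ, c ≤ z.re → ‖g z‖ ≤ M / ‖z‖ ^ 2) :
    ∫ ξ, g (vline c ξ) = 0 := by
  have hM0 : 0 ≤ M := by
    have h := (norm_nonneg _).trans (hM (c : ℂ) (by simp))
    have hn : 0 < ‖(c : ℂ)‖ ^ 2 := by
      have : (c : ℂ) ≠ 0 := by exact_mod_cast hc.ne'
      positivity
    by_contra hneg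
    exact absurd h (not_le.2 (div_neg_of_neg_of_pos (not_le.1 hneg) hn))
  have hint := integrable_comp_vline hc hg.continuousOn hM
  have hpi : 2 * Real.pi ≠ 0 := by positivity
  set G : ℝ → V := fun y => g (c + y * Complex.I) with hG
  have hvG : (fun ξ => g (vline c ξ)) = fun ξ => G (2 * Real.pi * ξ) := rfl
  rw [hvG] at hint ⊢
  rw [Measure.integral_comp_mul_left]
  have hGint : Integrable G := (integrable_comp_mul_left_iff G hpi).1 hint
  have hlim := intervalIntegral_tendsto_integral hGint tendsto_neg_atTop_atBot tendsto_id
  suffices h0 : Tendsto (fun T : ℝ => ∫ y in (-T)..T, G y) atTop (𝓝 0) by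
    rw [tendsto_nhds_unique hlim h0, smul_zero]
  refine squeeze_zero_norm' (a := fun T : ℝ => 4 * M / T) ?_
    (tendsto_const_nhds.div_atTop tendsto_id)
  filter_upwards [eventually_gt_atTop 0] with T hT
  -- any point of the half plane with real or imaginary part of size `T` has `|g| ≤ M / T²`
  have hbig : ∀ z : ℂ, c ≤ z.re → T ≤ ‖z‖ → ‖g z‖ ≤ M / T ^ 2 := fun z hz hzT =>
    (hM z hz).trans (by gcongr)
  have hrect := Complex.integral_boundary_rect_eq_zero_of_differentiableOn g
    (c + (-T : ℝ) * Complex.I) ((c + T : ℝ) + (T : ℝ) * Complex.I) (hg.mono ?_)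
  · simp only [Complex.add_re, Complex.ofReal_re, Complex.mul_re, Complex.I_re, mul_zero,
      Complex.ofReal_im, Complex.I_im, mul_one, sub_self, add_zero, Complex.add_im,
      Complex.mul_im, zero_add] at hrect
    have hb1 : ∀ σ : ℝ, |σ| = T →
        ‖∫ x : ℝ in c..(c + T), g (x + σ * Complex.I)‖ ≤ M / T := by
      intro σ hσ
      have := intervalIntegral.norm_integral_le_of_norm_le_const (a := c) (b := c + T)
        (f := fun x : ℝ => g (x + σ * Complex.I)) (C := M / T ^ 2) fun x hx => by
          rw [uIoc_of_le (by linarith)] at hx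
          refine hbig _ (by simpa using hx.1.le) ?_
          have h := Complex.abs_im_le_norm (x + σ * Complex.I)
          simpa [hσ] using h
      refine this.trans_eq ?_
      rw [add_sub_cancel_left, abs_of_pos hT]
      field_simp
    have hb2 : ‖∫ y : ℝ in (-T)..T, g ((c + T : ℝ) + y * Complex.I)‖ ≤ 2 * M / T := by
      have := intervalIntegral.norm_integral_le_of_norm_le_const (a := -T) (b := T)
        (f := fun y : ℝ => g ((c + T : ℝ) + y * Complex.I)) (C := M / T ^ 2) fun y _ => by
          refine hbig _ (by simp [hT.le]) ?_
          have h := Complex.abs_re_le_norm ((c + T : ℝ) + y * Complex.I)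
          rw [show ((c + T : ℝ) + y * Complex.I : ℂ).re = c + T by simp] at h
          exact (by linarith : T ≤ c + T).trans ((le_abs_self _).trans h)
      refine this.trans_eq ?_
      rw [sub_neg_eq_add, ← two_mul, abs_of_pos (by positivity)]
      field_simp
    have hI : Complex.I • (∫ y in (-T)..T, G y) =
        (∫ x : ℝ in c..(c + T), g (x + (-T : ℝ) * Complex.I))
        - (∫ x : ℝ in c..(c + T), g (x + T * Complex.I))
        + Complex.I • ∫ y : ℝ in (-T)..T, g ((c + T : ℝ) + y * Complex.I) :=
      (sub_eq_zero.1 hrect).symm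
    calc ‖∫ y in (-T)..T, G y‖ = ‖Complex.I • (∫ y in (-T)..T, G y)‖ := by
          rw [norm_smul, Complex.norm_I, one_mul]
      _ ≤ M / T + M / T + 2 * M / T := by
          rw [hI]
          refine (norm_add_le _ _).trans (add_le_add ((norm_sub_le _ _).trans
            (add_le_add (hb1 _ ?_) (hb1 _ (abs_of_pos hT)))) ?_)
          · rw [abs_neg, abs_of_pos hT]
          · rw [norm_smul, Complex.norm_I, one_mul]
            exact hb2
      _ = 4 * M / T := by ring
  · intro z hz
    have h1 := (Complex.mem_reProdIm.1 hz).1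
    simp only [Complex.add_re, Complex.ofReal_re, Complex.mul_re, Complex.I_re, mul_zero,
      Complex.ofReal_im, Complex.I_im, mul_one, sub_self, add_zero] at h1
    rw [uIcc_of_le (by linarith)] at h1
    exact h1.1

/-! ### The inverse Laplace transform of a power -/

theorem integrableOn_pow_mul_exp_neg (n : ℕ) {z : ℂ} (hz : 0 < z.re) :
    IntegrableOn (fun t : ℝ => (t : ℂ) ^ n * Complex.exp (-(z * t))) (Ioi 0) := by
  have h := integrableOn_rpow_mul_exp_neg_mul_rpow (p := 1) (s := n) (b := z.re)
    (by linarith [n.cast_nonneg (α := ℝ)]) one_pos hz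
  refine Integrable.mono' h (Continuous.aestronglyMeasurable (by fun_prop))
    ((ae_restrict_iff' measurableSet_Ioi).2 (ae_of_all _ fun t ht => ?_))
  rw [norm_mul, norm_pow, Complex.norm_real, Real.norm_of_nonneg (le_of_lt ht), Complex.norm_exp]
  simp

/-- The Laplace transform of `t ^ n`, for complex argument. -/
theorem integral_pow_mul_exp_neg (n : ℕ) {z : ℂ} (hz : 0 < z.re) :
    ∫ t in Ioi (0 : ℝ), (t : ℂ) ^ n * Complex.exp (-(z * t)) = n.factorial / z ^ (n + 1) := by
  have hz0 : z ≠ 0 := fun h => by simp [h] at hz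
  have htend : ∀ n : ℕ,
      Tendsto (fun t : ℝ => (t : ℂ) ^ n * Complex.exp (-(z * t))) atTop (𝓝 0) := by
    intro n
    refine tendsto_zero_iff_norm_tendsto_zero.2 ?_
    refine (tendsto_rpow_mul_exp_neg_mul_atTop_nhds_zero n z.re hz).congr' ?_
    filter_upwards [eventually_gt_atTop 0] with t ht
    rw [norm_mul, norm_pow, Complex.norm_real, Real.norm_of_nonneg ht.le, Complex.norm_exp]
    simp
  have hexp : ∀ t : ℝ, HasDerivAt (fun t : ℝ => Complex.exp (-(z * t)))
      (-(z * Complex.exp (-(z * t)))) t := fun t => by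
    have h1 : HasDerivAt (fun t : ℝ => -(z * (t : ℂ))) (-(z * 1)) t :=
      ((Complex.ofRealCLM.hasDerivAt (x := t)).const_mul z).neg
    convert h1.cexp using 1
    ring
  induction n with
  | zero =>
    have h := integral_Ioi_of_hasDerivAt_of_tendsto' (a := 0)
      (f := fun t : ℝ => Complex.exp (-(z * t))) (fun t _ => hexp t)
      (((integrableOn_pow_mul_exp_neg 0 hz).const_mul (-z)).congr (ae_of_all _ fun t => by simp))
      (by simpa using htend 0)
    rw [integral_neg, integral_const_mul] at h
    simp only [pow_zero, one_mul, Nat.factorial_zero, Nat.cast_one, zero_add, pow_one]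
    rw [eq_div_iff hz0]
    simp only [Complex.ofReal_zero, mul_zero, neg_zero, Complex.exp_zero] at h
    linear_combination -h
  | succ n ih =>
    have hpow : ∀ t : ℝ, HasDerivAt (fun t : ℝ => (t : ℂ) ^ (n + 1)) ((n + 1) * (t : ℂ) ^ n) t :=
      fun t => by
        have h1 := (Complex.ofRealCLM.hasDerivAt (x := t)).pow (n + 1)
        exact h1.congr_deriv (by simp)
    have hi0 := (integrableOn_pow_mul_exp_neg n hz).const_mul ((n : ℂ) + 1)
    have hi1 := (integrableOn_pow_mul_exp_neg (n + 1) hz).const_mul (-z)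
    -- the derivative of `t ^ (n + 1) e ^ (-zt)` integrates to zero, which is the recursion
    have h := integral_Ioi_of_hasDerivAt_of_tendsto' (a := 0)
      (f := fun t : ℝ => (t : ℂ) ^ (n + 1) * Complex.exp (-(z * t)))
      (f' := fun t : ℝ => ((n : ℂ) + 1) * ((t : ℂ) ^ n * Complex.exp (-(z * t)))
        + -z * ((t : ℂ) ^ (n + 1) * Complex.exp (-(z * t))))
      (fun t _ => ((hpow t).mul (hexp t)).congr_deriv (by ring))
      (hi0.add hi1) (htend (n + 1))
    rw [integral_add hi0 hi1, integral_const_mul, integral_const_mul, ih] at h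
    simp only [Complex.ofReal_zero, zero_pow n.succ_ne_zero, zero_mul, sub_zero] at h
    have hzn : z ^ (n + 1) ≠ 0 := pow_ne_zero _ hz0
    rw [eq_div_iff (pow_ne_zero _ hz0), Nat.factorial_succ]
    push_cast
    field_simp at h
    linear_combination -h

theorem norm_inv_pow_le_of_le_re {c : ℝ} (hc : 0 < c) (n : ℕ) {z : ℂ} (hz : c ≤ z.re) :
    ‖(z ^ (n + 2))⁻¹‖ ≤ (c ^ n)⁻¹ / ‖z‖ ^ 2 := by
  have hcz : c ≤ ‖z‖ := hz.trans (Complex.re_le_norm z)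
  have hz0 : 0 < ‖z‖ := hc.trans_le hcz
  rw [norm_inv, norm_pow, pow_add, mul_inv, div_eq_mul_inv]
  gcongr

theorem differentiableOn_inv_pow {c : ℝ} (hc : 0 < c) (n : ℕ) :
    DifferentiableOn ℂ (fun z : ℂ => (z ^ n)⁻¹) {z | c ≤ z.re} := by
  intro z hz
  have hz0 : z ≠ 0 := fun h => by
    rw [h] at hz
    exact absurd (show c ≤ (0 : ℂ).re from hz) (by simpa using hc)
  exact ((differentiable_id.pow n).differentiableAt.inv
    (by simpa using pow_ne_zero n hz0)).differentiableWithinAt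

/-- The inverse Laplace transform of `z ^ (-(n + 2))`, obtained from Fourier inversion. -/
theorem integral_exp_vline_mul_inv_pow {c : ℝ} (hc : 0 < c) (n : ℕ) {t : ℝ} (ht : 0 < t) :
    ∫ ξ, Complex.exp (vline c ξ * t) * (vline c ξ ^ (n + 2))⁻¹ =
      (t : ℂ) ^ (n + 1) / (n + 1).factorial := by
  -- `f` is `s ^ (n + 1) e ^ (-cs)` on `s > 0`; its Fourier transform at `ξ` is its Laplace
  -- transform at `c + 2πiξ`
  set f : ℝ → ℂ := (Ioi 0).indicator fun s : ℝ => (s : ℂ) ^ (n + 1) * Complex.exp (-(c * s))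
    with hf
  have hfint : Integrable f :=
    (integrable_indicator_iff measurableSet_Ioi).2
      (integrableOn_pow_mul_exp_neg (n + 1) (z := c) (by simpa using hc))
  have hF : ∀ ξ, 𝓕 f ξ = (n + 1).factorial * (vline c ξ ^ (n + 2))⁻¹ := by
    intro ξ
    have h1 := integral_pow_mul_exp_neg (n + 1) (z := vline c ξ) (by simpa using hc)
    rw [Real.fourier_real_eq_integral_exp_smul, ← div_eq_mul_inv, ← h1, ← integral_indicator
      measurableSet_Ioi]
    congr 1 with s
    by_cases hs : s ∈ Ioi (0 : ℝ)
    · rw [hf, indicator_of_mem hs, indicator_of_mem hs, smul_eq_mul, mul_left_comm,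
        ← Complex.exp_add]
      congr 2
      rw [vline]
      push_cast
      ring
    · rw [hf, indicator_of_notMem hs, indicator_of_notMem hs, smul_zero]
  have hinv : Integrable fun ξ => (vline c ξ ^ (n + 2))⁻¹ :=
    integrable_comp_vline hc (differentiableOn_inv_pow hc (n + 2)).continuousOn
      fun z hz => norm_inv_pow_le_of_le_re hc n hz
  have hFint : Integrable (𝓕 f) := by
    rw [funext hF]
    exact hinv.const_mul _
  have hcont : ContinuousAt f t := by
    have h1 : ContinuousAt (fun s : ℝ => (s : ℂ) ^ (n + 1) * Complex.exp (-(c * s))) t := by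
      fun_prop
    refine h1.congr ?_
    filter_upwards [Ioi_mem_nhds ht] with s hs
    rw [hf, indicator_of_mem hs]
  have hmain := hfint.fourierInv_fourier_eq hFint hcont
  rw [Real.fourierInv_eq', hf, indicator_of_mem (show t ∈ Ioi (0 : ℝ) from ht)] at hmain
  rw [← hf] at hmain
  have hfac : ((n + 1).factorial : ℂ) ≠ 0 := by exact_mod_cast (n + 1).factorial_ne_zero
  rw [eq_div_iff hfac, ← integral_mul_const]
  calc _ = ∫ ξ : ℝ, Complex.exp (c * t) *
        (Complex.exp (↑(2 * Real.pi * inner ℝ ξ t) * Complex.I) • 𝓕 f ξ) := by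
        congr 1 with ξ
        have he : vline c ξ * t = c * t + ↑(2 * Real.pi * inner ℝ ξ t) * Complex.I := by
          simp [vline]
          ring
        rw [hF, smul_eq_mul, he, Complex.exp_add]
        ring
    _ = _ := by
        rw [integral_const_mul, hmain, mul_left_comm, ← Complex.exp_add]
        simp

end

section
variable {X Y : Type*} [NormedAddCommGroup X] [NormedSpace ℂ X]
  [NormedAddCommGroup Y] [NormedSpace ℂ Y] {E : X →L[ℂ] Y} {A : X →ₗ.[ℂ] Y}

/-! ### Holomorphy of the resolvent -/

/-- The resolvent identity `(zE + A)⁻¹ = (wE + A)⁻¹ - (z - w) (zE + A)⁻¹ E (wE + A)⁻¹`. -/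
theorem resolvent_apply_eq {z w : ℂ} (hz : z ∈ resolventSet E A) (hw : w ∈ resolventSet E A)
    (y : Y) : resolvent E A z y =
      resolvent E A w y - (z - w) • resolvent E A z (E (resolvent E A w y)) := by
  obtain ⟨h, hy⟩ := (resolvent_spec E A hw).2 y
  have h' : resolvent E A w y ∈ A.domain := h
  have hy' : w • E (resolvent E A w y) + A ⟨resolvent E A w y, h'⟩ = y := hy
  have hz' := resolvent_apply_of_mem hz ⟨_, h'⟩
  rw [eq_sub_of_add_eq' hy'] at hz'
  have hz'' : resolvent E A z (z • E (resolvent E A w y) + (y - w • E (resolvent E A w y))) =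
    resolvent E A w y := hz'
  conv_rhs => arg 1; rw [← hz'']
  simp only [map_add, map_sub, map_smul]
  module

variable {ρ₀ : ℝ} {k : ℕ}

/-- By the resolvent identity, a locally bounded resolvent is strongly continuous. -/
theorem continuousOn_resolvent (hρ : {z : ℂ | ρ₀ ≤ z.re} ⊆ resolventSet E A)
    (hk : ResolventBound E A ρ₀ k) (y : Y) :
    ContinuousOn (fun z => resolvent E A z y) {z : ℂ | ρ₀ ≤ z.re} := by
  obtain ⟨C, hC, hb⟩ := hk
  intro w hw
  refine tendsto_iff_norm_sub_tendsto_zero.2 ?_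
  refine squeeze_zero' (g := fun z : ℂ => ‖z - w‖ * (C * ‖z‖ ^ k * ‖E (resolvent E A w y)‖))
    (Eventually.of_forall fun z => norm_nonneg _) ?_ ?_
  · filter_upwards [self_mem_nhdsWithin] with z hz
    rw [resolvent_apply_eq (hρ hz) (hρ hw) y, sub_sub_cancel_left, norm_neg, norm_smul]
    refine mul_le_mul_of_nonneg_left ?_ (norm_nonneg _)
    exact (resolvent E A z).le_of_opNorm_le (hb z hz) _
  · have hcont : Continuous fun z : ℂ =>
        ‖z - w‖ * (C * ‖z‖ ^ k * ‖E (resolvent E A w y)‖) := by fun_prop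
    have h := hcont.tendsto w
    simp only [sub_self, norm_zero, zero_mul] at h
    exact h.mono_left nhdsWithin_le_nhds

theorem differentiableOn_resolvent (hρ : {z : ℂ | ρ₀ ≤ z.re} ⊆ resolventSet E A)
    (hk : ResolventBound E A ρ₀ k) (y : Y) :
    DifferentiableOn ℂ (fun z => resolvent E A z y) {z : ℂ | ρ₀ ≤ z.re} := by
  intro w hw
  suffices h : HasDerivWithinAt (fun z => resolvent E A z y)
      (-resolvent E A w (E (resolvent E A w y))) {z : ℂ | ρ₀ ≤ z.re} w from
    h.differentiableWithinAt
  refine hasDerivWithinAt_iff_tendsto_slope.2 ?_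
  have hc := (continuousOn_resolvent hρ hk (E (resolvent E A w y)) w hw).neg
  refine (hc.mono_left (nhdsWithin_mono w sdiff_subset)).congr' ?_
  filter_upwards [self_mem_nhdsWithin] with z hz
  have hzw : z - w ≠ 0 := sub_ne_zero.2 hz.2
  rw [slope_def_module, resolvent_apply_eq (hρ hz.1) (hρ hw) y, sub_sub_cancel_left, smul_neg,
    smul_smul, inv_mul_cancel₀ hzw, one_smul]
  rfl

/-! ### Solutions driven by powers of time -/

/-- `u` is continuous and satisfies `E u(t) + A ∫₀ᵗ u = (t ^ m / m!) y` for all `t > 0`, which is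
the integrated form of `E u' + A u = (t ^ (m - 1) / (m - 1)!) y` if `m ≥ 1`. For `m = 0` and
`y = E (u 0)` it says that `u` is a mild solution. -/
def IsPowerResponse (E : X →L[ℂ] Y) (A : X →ₗ.[ℂ] Y) (m : ℕ) (y : Y) (u : ℝ → X) : Prop :=
  Continuous u ∧ ∀ t : ℝ, 0 < t → ∃ h : (∫ s in (0 : ℝ)..t, u s) ∈ A.domain,
    E (u t) + A ⟨∫ s in (0 : ℝ)..t, u s, h⟩ = ((t : ℂ) ^ m / m.factorial) • y

/-- When the resolvent is of order `|z| ^ k`, the inverse Laplace transform of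
`z ^ (-(k + 2)) (zE + A)⁻¹ y` converges absolutely and responds to `t ^ (k + 2) / (k + 2)! • y`. -/
theorem exists_isPowerResponse [CompleteSpace X] [CompleteSpace Y]
    (hρ : {z : ℂ | ρ₀ ≤ z.re} ⊆ resolventSet E A) (hk : ResolventBound E A ρ₀ k) (y : Y) :
    ∃ u : ℝ → X, IsPowerResponse E A (k + 2) y u ∧ u 0 = 0 := by
  obtain ⟨c, hcρ, hc⟩ : ∃ c, ρ₀ ≤ c ∧ 0 < c :=
    ⟨max ρ₀ 1, le_max_left _ _, zero_lt_one.trans_le (le_max_right _ _)⟩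
  have hsub : {z : ℂ | c ≤ z.re} ⊆ {z : ℂ | ρ₀ ≤ z.re} := fun z hz => hcρ.trans hz
  set r : ℂ → X := fun z => (z ^ (k + 2))⁻¹ • resolvent E A z y with hr
  have hrd : DifferentiableOn ℂ r {z | c ≤ z.re} :=
    (differentiableOn_inv_pow hc (k + 2)).smul ((differentiableOn_resolvent hρ hk y).mono hsub)
  obtain ⟨C, hC, hb⟩ := hk
  have hrb : ∀ z : ℂ, c ≤ z.re → ‖r z‖ ≤ C * ‖y‖ / ‖z‖ ^ 2 := by
    intro z hz
    have hz0 : 0 < ‖z‖ := hc.trans_le (hz.trans (Complex.re_le_norm z))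
    calc ‖r z‖ = (‖z‖ ^ (k + 2))⁻¹ * ‖resolvent E A z y‖ := by
          rw [hr, norm_smul, norm_inv, norm_pow]
      _ ≤ (‖z‖ ^ (k + 2))⁻¹ * (C * ‖z‖ ^ k * ‖y‖) := by
          gcongr
          exact (resolvent E A z).le_of_opNorm_le (hb z (hsub hz)) _
      _ = C * ‖y‖ / ‖z‖ ^ 2 := by
          rw [pow_add]
          field_simp
  have hrint := integrable_comp_vline hc hrd.continuousOn hrb
  have hr0 : ∫ ξ, r (vline c ξ) = 0 := integral_comp_vline_eq_zero hc hrd hrb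
  set w : ℝ → X := fun t => ∫ ξ, Complex.exp (vline c ξ * t) • r (vline c ξ) with hw
  refine ⟨w, ⟨continuous_integral_exp_vline_smul hrint, fun t ht => ?_⟩, by simp [hw, hr0]⟩
  have hcmem : (c : ℂ) ∈ resolventSet E A := hρ (by simpa using hcρ)
  have hGeq := integral_integral_exp_vline_smul hc hrint t
  set G : X := ∫ s in (0 : ℝ)..t, w s with hG
  -- `G` is the integral of `g`, and `w t` is the integral of `p`, because `∫ r = 0`;
  -- `q` is the integrand of the scalar integral whose value is `t ^ (k + 2) / (k + 2)!`
  set q : ℝ → ℂ := fun ξ => (Complex.exp (vline c ξ * t) - 1) * (vline c ξ ^ (k + 1 + 2))⁻¹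
    with hq
  have hpint : Integrable fun ξ => (vline c ξ ^ (k + 1 + 2))⁻¹ :=
    integrable_comp_vline hc (differentiableOn_inv_pow hc (k + 1 + 2)).continuousOn
      fun z hz => norm_inv_pow_le_of_le_re hc (k + 1) hz
  have hp0 : ∫ ξ, (vline c ξ ^ (k + 1 + 2))⁻¹ = 0 :=
    integral_comp_vline_eq_zero hc (differentiableOn_inv_pow hc (k + 1 + 2))
      fun z hz => norm_inv_pow_le_of_le_re hc (k + 1) hz
  have hep : Integrable fun ξ => Complex.exp (vline c ξ * t) * (vline c ξ ^ (k + 1 + 2))⁻¹ :=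
    integrable_exp_vline_smul (c := c) t hpint
  have hqint : Integrable q := by
    refine (hep.sub hpint).congr (ae_of_all _ fun ξ => ?_)
    simp only [hq, Pi.sub_apply]
    ring
  have hqval : ∫ ξ, q ξ = (t : ℂ) ^ (k + 2) / (k + 2).factorial := by
    simp_rw [hq, sub_mul, one_mul]
    rw [integral_sub hep hpint, hp0, sub_zero]
    exact integral_exp_vline_mul_inv_pow hc (k + 1) ht
  set p : ℝ → X := fun ξ => (Complex.exp (vline c ξ * t) - 1) • r (vline c ξ) with hp
  have her := integrable_exp_vline_smul (c := c) t hrint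
  have hppint : Integrable p := by
    refine (her.sub hrint).congr (ae_of_all _ fun ξ => ?_)
    simp only [hp, Pi.sub_apply, sub_smul, one_smul]
  have hpval : ∫ ξ, p ξ = w t := by
    simp_rw [hp, sub_smul, one_smul]
    rw [integral_sub her hrint, hr0, sub_zero]
  set g : ℝ → X := fun ξ => ((Complex.exp (vline c ξ * t) - 1) / vline c ξ) • r (vline c ξ)
    with hg
  have hgint : Integrable g := by
    have hcont : Continuous fun ξ => (vline c ξ)⁻¹ :=
      (continuous_vline c).inv₀ (vline_ne_zero hc)
    have h := hppint.bdd_smul c⁻¹ hcont.aestronglyMeasurable (ae_of_all _ fun ξ => by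
      rw [norm_inv]
      have := Complex.re_le_norm (vline c ξ)
      rw [vline_re] at this
      gcongr)
    refine h.congr (ae_of_all _ fun ξ => ?_)
    change (vline c ξ)⁻¹ • p ξ = g ξ
    simp only [hp, hg, smul_smul, div_eq_inv_mul]
  -- the equation for `w` before integration over the line: with `z = c + 2πiξ` and
  -- `q = (exp (z t) - 1) / z ^ (k + 3)`, one has `g = q (zE + A)⁻¹ y` and `p = z g`, hence
  -- `A g = q y - E p`, written here with the fixed resolvent `(cE + A)⁻¹`
  have hpt : ∀ ξ, g ξ = resolvent E A c ((c : ℂ) • E (g ξ) + (q ξ • y - E (p ξ))) := by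
    intro ξ
    have hL0 := vline_ne_zero hc ξ
    have hL : vline c ξ ∈ resolventSet E A := hρ (by simpa using hcρ)
    have hres := resolvent_apply_eq hcmem hL y
    have hg1 : g ξ = q ξ • resolvent E A (vline c ξ) y := by
      simp only [hg, hq, hr, smul_smul]
      congr 1
      field_simp
      ring
    have hp1 : p ξ = (q ξ * vline c ξ) • resolvent E A (vline c ξ) y := by
      simp only [hp, hq, hr, smul_smul]
      congr 1
      field_simp
      ring
    rw [hg1, hp1]
    simp only [map_add, map_sub, map_smul]
    rw [hres]
    module
  have hqy : Integrable fun ξ => q ξ • y := hqint.smul_const y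
  have hEp : Integrable fun ξ => E (p ξ) := E.integrable_comp hppint
  have hcg : Integrable fun ξ => (c : ℂ) • E (g ξ) := (E.integrable_comp hgint).smul (c : ℂ)
  have hdiff : Integrable fun ξ => q ξ • y - E (p ξ) := hqy.sub hEp
  have hsum : Integrable fun ξ => (c : ℂ) • E (g ξ) + (q ξ • y - E (p ξ)) := hcg.add hdiff
  have hGfix : G = resolvent E A c
      ((c : ℂ) • E G + (((t : ℂ) ^ (k + 2) / (k + 2).factorial) • y - E (w t))) := by
    have h1 : G = ∫ ξ, g ξ := hGeq
    conv_lhs => rw [h1, integral_congr_ae (ae_of_all _ hpt)]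
    rw [(resolvent E A c).integral_comp_comm hsum,
      integral_add hcg hdiff, integral_sub hqy hEp, integral_smul,
      E.integral_comp_comm hgint, E.integral_comp_comm hppint, integral_smul_const, hqval, hpval,
      ← h1]
  obtain ⟨h, hA⟩ := exists_mem_domain_of_resolvent hcmem hGfix
  exact ⟨h, by rw [hA]; abel⟩

theorem integral_pow_div_factorial_smul [CompleteSpace X] (m : ℕ) (t : ℝ) (x : X) :
    ∫ s in (0 : ℝ)..t, ((s : ℂ) ^ m / m.factorial) • x =
      ((t : ℂ) ^ (m + 1) / (m + 1).factorial) • x := by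
  rw [intervalIntegral.integral_smul_const, intervalIntegral.integral_div]
  have h : ∫ s in (0 : ℝ)..t, (s : ℂ) ^ m = (t : ℂ) ^ (m + 1) / (m + 1) := by
    have h1 : ∀ s : ℝ, (s : ℂ) ^ m = ((s ^ m : ℝ) : ℂ) := fun s => by push_cast; rfl
    simp_rw [h1]
    rw [intervalIntegral.integral_ofReal, integral_pow]
    push_cast
    simp
  rw [h, Nat.factorial_succ]
  push_cast
  rw [div_div]

/-- Subtracting a response to `t ^ (m + 1) / (m + 1)! • A x` from
`t ^ m / m! • x` gives a response to `t ^ m / m! • E x`. -/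
theorem IsPowerResponse.sub [CompleteSpace X] {m : ℕ} (x : A.domain) {w : ℝ → X}
    (hw : IsPowerResponse E A (m + 1) (A x) w) :
    IsPowerResponse E A m (E x) fun t => ((t : ℂ) ^ m / m.factorial) • (x : X) - w t := by
  have hc : Continuous fun t : ℝ => ((t : ℂ) ^ m / m.factorial) • (x : X) := by fun_prop
  refine ⟨hc.sub hw.1, fun t ht => ?_⟩
  obtain ⟨h, he⟩ := hw.2 t ht
  have hint : ∫ s in (0 : ℝ)..t, (((s : ℂ) ^ m / m.factorial) • (x : X) - w s) =
      (((t : ℂ) ^ (m + 1) / (m + 1).factorial) • x - ⟨_, h⟩ : A.domain) := by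
    rw [intervalIntegral.integral_sub (hc.intervalIntegrable _ _) (hw.1.intervalIntegrable _ _),
      integral_pow_div_factorial_smul]
    rfl
  simp only [hint]
  refine ⟨Subtype.coe_prop _, ?_⟩
  rw [Subtype.coe_eta, A.map_sub, A.map_smul, map_sub, map_smul, ← he]
  abel

/-- Each step up in the Wong sequence lowers by one the power of time that can be responded to;
at level `k + 1` the constant right-hand side `E x` is reached. -/
theorem exists_isPowerResponse_of_mem_IV [CompleteSpace X] [CompleteSpace Y]
    (hρ : {z : ℂ | ρ₀ ≤ z.re} ⊆ resolventSet E A) (hk : ResolventBound E A ρ₀ k) {j m : ℕ}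
    (hjm : m + j = k + 1) {x : X} (hx : x ∈ IV E A j) :
    ∃ u : ℝ → X, IsPowerResponse E A m (E x) u ∧ u 0 = (0 : ℂ) ^ m • x := by
  have step : ∀ {m : ℕ} (x : A.domain) {w : ℝ → X}, IsPowerResponse E A (m + 1) (A x) w →
      w 0 = 0 → ∃ u : ℝ → X, IsPowerResponse E A m (E x) u ∧ u 0 = (0 : ℂ) ^ m • (x : X) := by
    intro m x w hw hw0
    refine ⟨_, hw.sub x, ?_⟩
    rcases m with _ | m <;> simp [hw0]
  induction j generalizing m x with
  | zero =>
    obtain rfl : m = k + 1 := hjm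
    obtain ⟨w, hw, hw0⟩ := exists_isPowerResponse hρ hk (A ⟨x, hx⟩)
    exact step ⟨x, hx⟩ hw hw0
  | succ j ih =>
    obtain ⟨hxd, x', hx', he⟩ := (mem_IV_succ E A j x).1 hx
    obtain ⟨w, hw, hw0⟩ := ih (m := m + 1) (by omega) hx'
    rw [he] at hw
    exact step ⟨x, hxd⟩ hw (by rw [hw0, zero_pow m.succ_ne_zero, zero_smul])

/-! ### Consistent initial values -/

theorem mem_consistentInitialValues_of_mem_IV [CompleteSpace X] [CompleteSpace Y]
    (hρ : {z : ℂ | ρ₀ ≤ z.re} ⊆ resolventSet E A) (hk : ResolventBound E A ρ₀ k) {x : X}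
    (hx : x ∈ IV E A (k + 1)) : x ∈ consistentInitialValues E A := by
  obtain ⟨u, hu, hu0⟩ := exists_isPowerResponse_of_mem_IV (m := 0) hρ hk (by omega) hx
  refine ⟨u, hu.1.continuousOn, by simpa using hu0, fun t ht => ?_⟩
  simpa using hu.2 t ht

end

end DAE

theorem mainTheorem2 {X Y : Type*}
    [NormedAddCommGroup X] [InnerProductSpace ℂ X] [CompleteSpace X]
    [NormedAddCommGroup Y] [NormedSpace ℂ Y] [CompleteSpace Y]
    (E : X →L[ℂ] Y) (A : X →ₗ.[ℂ] Y)
    (hA_dense : Dense (A.domain : Set X)) (hA_closed : A.IsClosed)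
    (ρ₀ : ℝ) (hpoly : DAE.PolynomiallyBounded E A ρ₀)
    (hU_closed : IsClosed (DAE.consistentInitialValues E A))
    (hU_unique : ∀ u₀ ∈ DAE.consistentInitialValues E A, ∀ u v : ℝ → X,
      DAE.IsMildSolution E A u₀ u → DAE.IsMildSolution E A u₀ v → Set.EqOn u v (Set.Ici 0)) :
    DAE.consistentInitialValues E A =
      closure (DAE.IV E A (DAE.ind E A ρ₀ + 1) : Set X) := by
  obtain ⟨hρ, hex⟩ := hpoly
  have hind : DAE.ResolventBound E A ρ₀ (DAE.ind E A ρ₀) := Nat.sInf_mem hex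
  refine Set.Subset.antisymm ?_ (closure_minimal ?_ hU_closed)
  · rintro u₀ ⟨u, hu⟩
    have hz : (ρ₀ : ℂ) ∈ DAE.resolventSet E A := hρ (by simp)
    exact hu.initial_mem_closure_IV hz _
  · exact fun x hx => DAE.mem_consistentInitialValues_of_mem_IV hρ hind hx
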